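/- Let $\mathfrak h$ be a finite-dimensional real vector space with dual $\mathfrak h^*$, let $I$ be a finite set, and let $(H_i,L_i)_{i\in I}$ be a linear Coxeter system in the sense of Vinberg. That is, $H_i\subseteq\mathfrak h$ and $L_i\subseteq\mathfrak h^*$ are closed rays starting at $0$ such that every nonzero element of $L_i$ is positive on $H_i\setminus\{0\}$, and, writing $H_i^{=0}:=\{\lambda\in\mathfrak h^*\mid \lambda|_{H_i}=0\}$, the following hold. (a) The cone $\overline C:=\{\lambda\in\mathfrak h^*\mid \lambda|_{H_i}\ge 0\text{ for all } i\in I\}$ spans $\mathfrak h^*$, the sets $\overline C\cap H_i^{=0}$ $(i\in I)$ are pairwise different, and they are exactly the faces of $\overline C$ of codimension one. (b) Let $C:=\{\lambda\in\mathfrak h^*\mid \lambda|_{H_i\setminus\{0\}}>0\text{ for all } i\in I\}$, and let $W\subseteq GL(\mathfrak h^*)$ be the group generated by the reflections $\sigma_i$, where $\sigma_i$ is the identity on $H_i^{=0}$ and $-\mathrm{id}$ on the line $L_i\cup -L_i$. Then $\sigma C\cap C=\emptyset$ for all $\sigma\in W\setminus\{1\}$. Let $X:=\bigcup_{\sigma\in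 W}\sigma\overline C$ be the Tits cone, let $K^\vee:=\bigl(\sum_{i\in I}L_i\bigr)\cap(-\overline C)$, and let $Z^\vee:=\bigcup_{\sigma\in W}\sigma K^\vee$ be the dual imaginary cone. (1) Let $Y$ be a $W$-invariant convex subcone of $X$ that contains $0$. If $W$ acts faithfully on $Y$ and $Y\cap\overline C$ is closed in $\mathfrak h^*$, then $-Z^\vee\subseteq Y$. (2) Choose $h_i\in H_i$ and $\alpha_i\in L_i$ with $\alpha_i(h_i)=2$ for all $i\in I$, and let $A=(a_{ij})_{i,j\in I}$ with $a_{ij}:=\alpha_j(h_i)$. Call distinct $i,j\in I$ adjacent if $a_{ij}\ne0$ or $a_{ji}\neq 0$, and call a connected component $J$ of the resulting graph on $I$ of indefinite type if the submatrix $A_J=(a_{ij})_{i,j\in J}$ satisfies: there is $u\in\mathbb R^J$ with all entries positive such that all entries of $A_Ju$ are negative, and $v\ge 0$, $A_Jv\ge0$ (entrywise) imply $v=0$ for $v\in\mathbb R^J$. If every connected component of $I$ is of indefinite type, then $-Z^\vee$ is itself a $W$-invariant convex subcone of $X$ containing $0$ on which $W$ acts faithfully and for which $(-Z^\vee)\cap\overline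 C$ is closed, and it is contained in every $W$-invariant convex subcone $Y$ of $X$ containing $0$ such that $W$ acts faithfully on $Y$ and $Y\cap\overline C$ is closed. -/

import Mathlib

open scoped Pointwise

namespace LinearCoxeter

section Rays

variable {ι E : Type*} [AddCommGroup E] [Module ℝ E]

/-- A zero-based closed ray in a real vector space. -/
def IsRay (R : Set E) : Prop :=
  ∃ v : E, v ≠ 0 ∧ R = {x | ∃ r : ℝ, 0 ≤ r ∧ x = r • v}

/-- `H^{≥ 0}`, the linear forms that are nonnegative on `H`. -/
def nonnegHalfSpace (H : Set E) : Set (Module.Dual ℝ E) :=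
  {φ | ∀ h ∈ H, 0 ≤ φ h}

/-- `H^{> 0}`, the linear forms that are positive on `H \ {0}`. -/
def posHalfSpace (H : Set E) : Set (Module.Dual ℝ E) :=
  {φ | ∀ h ∈ H \ {0}, 0 < φ h}

/-- `H^{= 0}`, the linear forms that vanish on `H`. -/
def zeroHyperplane (H : Set E) : Set (Module.Dual ℝ E) :=
  {φ | ∀ h ∈ H, φ h = 0}

/-- The closed chamber cut out by a family of rays. -/
def closedChamber (H : ι → Set E) : Set (Module.Dual ℝ E) :=
  ⋂ i, nonnegHalfSpace (H i)

/-- The open chamber cut out by a family of rays. -/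
def openChamber (H : ι → Set E) : Set (Module.Dual ℝ E) :=
  ⋂ i, posHalfSpace (H i)

/-- `σ` is the reflection of the dual space at the hyperplane `H^{= 0}` along the line `L ∪ -L`:
the identity on `H^{= 0}` and minus the identity on `L ∪ -L`. -/
def IsReflection (H : Set E) (L : Set (Module.Dual ℝ E))
    (σ : Module.Dual ℝ E ≃ₗ[ℝ] Module.Dual ℝ E) : Prop :=
  (∀ φ ∈ zeroHyperplane H, σ φ = φ) ∧ ∀ φ ∈ L ∪ -L, σ φ = -φ

/-- The subgroup of `GL(E*)` generated by the reflections that belong to the pairs `H i`, `L i`. -/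
def reflectionGroup (H : ι → Set E) (L : ι → Set (Module.Dual ℝ E)) :
    Subgroup (Module.Dual ℝ E ≃ₗ[ℝ] Module.Dual ℝ E) :=
  Subgroup.closure {σ | ∃ i, IsReflection (H i) (L i) σ}

end Rays

/-- A nonempty face of a convex set `K`. -/
structure IsFace {V : Type*} [AddCommGroup V] [Module ℝ V] (K F : Set V) : Prop where
  nonempty : F.Nonempty
  convex : Convex ℝ F
  isExtreme : IsExtreme ℝ K F

/-- A face of codimension one in the ambient space `V`; the dimension of a face of a cone is that
of its linear hull. -/
def IsFacet {V : Type*} [AddCommGroup V] [Module ℝ V] (K F : Set V) : Prop :=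
  IsFace K F ∧ Module.finrank ℝ (Submodule.span ℝ F) + 1 = Module.finrank ℝ V

end LinearCoxeter

open LinearCoxeter in
/-- A linear Coxeter system in the sense of Vinberg, with Tits cone in the dual of `𝔥`. -/
structure LinearCoxeterSystem (ι 𝔥 : Type*) [AddCommGroup 𝔥] [Module ℝ 𝔥] where
  /-- the rays in `𝔥` -/
  H : ι → Set 𝔥
  /-- the rays in the dual of `𝔥` -/
  L : ι → Set (Module.Dual ℝ 𝔥)
  isRay_H : ∀ i, IsRay (H i)
  isRay_L : ∀ i, IsRay (L i)
  L_subset : ∀ i, L i \ {0} ⊆ posHalfSpace (H i)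
  /-- the closed fundamental chamber spans the dual space -/
  span_closedChamber : Submodule.span ℝ (closedChamber H) = ⊤
  /-- the walls are pairwise different -/
  facet_injective : Function.Injective fun i => closedChamber H ∩ zeroHyperplane (H i)
  /-- the walls are exactly the one-codimensional faces of the closed fundamental chamber -/
  range_facet :
    Set.range (fun i => closedChamber H ∩ zeroHyperplane (H i)) = {F | IsFacet (closedChamber H) F}
  disjoint_openChamber : ∀ σ ∈ reflectionGroup H L, σ ≠ 1 →
    (σ '' openChamber H) ∩ openChamber H = ∅

namespace LinearCoxeterSystem

open LinearCoxeter

section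

variable {ι 𝔥 : Type*} [AddCommGroup 𝔥] [Module ℝ 𝔥] (S : LinearCoxeterSystem ι 𝔥)

/-- The linear Coxeter group, as a subgroup of `GL(𝔥*)`. -/
def W : Subgroup (Module.Dual ℝ 𝔥 ≃ₗ[ℝ] Module.Dual ℝ 𝔥) :=
  reflectionGroup S.H S.L

/-- The closed fundamental chamber. -/
def closedC : Set (Module.Dual ℝ 𝔥) :=
  closedChamber S.H

/-- The Tits cone. -/
def titsCone : Set (Module.Dual ℝ 𝔥) :=
  ⋃ σ ∈ S.W, σ '' S.closedC

/-- The sum of the rays `L i`, that is, the cone of nonnegative combinations of simple roots. -/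
def rootCone [Fintype ι] : Set (Module.Dual ℝ 𝔥) :=
  {β | ∃ f : ι → Module.Dual ℝ 𝔥, (∀ i, f i ∈ S.L i) ∧ β = ∑ i, f i}

/-- `K^∨`, the antidominant part of the cone of nonnegative combinations of simple roots. -/
def dualK [Fintype ι] : Set (Module.Dual ℝ 𝔥) :=
  S.rootCone ∩ -S.closedC

/-- `Z^∨`, the dual imaginary cone. -/
def dualImaginaryCone [Fintype ι] : Set (Module.Dual ℝ 𝔥) :=
  ⋃ σ ∈ S.W, σ '' S.dualK

/-- `Y` is a `W`-invariant convex subcone of the Tits cone which contains zero. -/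
structure IsInvariantSubcone (Y : Set (Module.Dual ℝ 𝔥)) : Prop where
  zero_mem : (0 : Module.Dual ℝ 𝔥) ∈ Y
  convex : Convex ℝ Y
  smul_mem : ∀ r : ℝ, 0 < r → ∀ y ∈ Y, r • y ∈ Y
  subset_titsCone : Y ⊆ S.titsCone
  invariant : ∀ σ ∈ S.W, ∀ y ∈ Y, σ y ∈ Y

/-- The only element of `W` that fixes `Y` pointwise is the identity. -/
def ActsFaithfullyOn (Y : Set (Module.Dual ℝ 𝔥)) : Prop :=
  ∀ σ ∈ S.W, (∀ y ∈ Y, σ y = y) → σ = 1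

open scoped Topology in
/-- `Y ∩ C̄` is closed for the canonical topology of the finite-dimensional space `𝔥*`. -/
def HasClosedChamberPart (Y : Set (Module.Dual ℝ 𝔥)) : Prop :=
  IsClosed[moduleTopology ℝ (Module.Dual ℝ 𝔥)] (Y ∩ S.closedC)

/-- `h`, `α` is a root base of the linear Coxeter system: representatives of the rays which are
normalized by `α i (h i) = 2`. -/
structure IsRootBase (h : ι → 𝔥) (α : ι → Module.Dual ℝ 𝔥) : Prop where
  h_mem : ∀ i, h i ∈ S.H i
  α_mem : ∀ i, α i ∈ S.L i
  pairing : ∀ i, α i (h i) = 2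

end

end LinearCoxeterSystem

namespace LinearCoxeter

/-- The generalized Cartan matrix `(α j (h i))` of a root base. -/
def cartanMatrix {ι 𝔥 : Type*} [AddCommGroup 𝔥] [Module ℝ 𝔥] (h : ι → 𝔥)
    (α : ι → Module.Dual ℝ 𝔥) : Matrix ι ι ℝ :=
  Matrix.of fun i j => α j (h i)

/-- The case (Ind) in the trichotomy of indecomposable generalized Cartan matrices into matrices of
finite, affine and indefinite type. -/
def IsIndefinite {κ : Type*} [Fintype κ] (A : Matrix κ κ ℝ) : Prop :=
  (∃ u : κ → ℝ, (∀ i, 0 < u i) ∧ ∀ i, (A.mulVec u) i < 0) ∧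
    ∀ v : κ → ℝ, (∀ i, 0 ≤ v i) → (∀ i, 0 ≤ (A.mulVec v) i) → v = 0

/-- The graph of a matrix: distinct indices are adjacent if an entry that links them is nonzero. -/
def matrixGraph {ι : Type*} (A : Matrix ι ι ℝ) : SimpleGraph ι :=
  SimpleGraph.fromRel fun i j => A i j ≠ 0

open Classical in
/-- `I^ind`, the union of the connected components of indefinite type of the index set. -/
noncomputable def indefinitePart {ι : Type*} [Fintype ι] (A : Matrix ι ι ℝ) : Set ι :=
  ⋃ c ∈ {c : (matrixGraph A).ConnectedComponent |
    IsIndefinite (A.submatrix (Subtype.val : c.supp → ι) (Subtype.val : c.supp → ι))}, c.supp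

end LinearCoxeter

/-! ### Geometry of a chamber and its walls -/

section

open Module Filter Topology

/-! Write `C` and `D` for the open and closed chamber, `Q` for the cone of nonnegative combinations
of the `α i`, `X` for the Tits cone, `Z` for the dual imaginary cone. Vinberg's theory follows from
the fact that nontrivial elements move `C` off itself: every translate of `C` lies strictly on one
side of each wall (`pos_or_neg`), which leads to the exchange condition and to induction on length
(`induction_W`). That induction shows that `D` is a fundamental domain, that `v - w v ∈ Q` for `v ∈
D`, and that `X` is convex.

Minimality: by invariance it is enough to reach `-v` for `v ∈ Q` with `-v ∈ D`. Faithfulness yields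
`y ∈ Y ∩ C` (`exists_mem_C_of_faithful`). Convexity and `s j y ∈ Y` allow small multiples of the `α
j` to be subtracted inside `Y` (`sub_sum_mem`). Subtracting a multiple of `v` lowers no coordinate
`x i`, so the step can be repeated, and `y - n δ v ∈ Y` for all `n`. After rescaling, these points
lie in `Y ∩ D` and tend to `-v`; closedness finishes.

The indefinite case: `-Z` consists of the `v ∈ X` with `-w v ∈ Q` for all `w`, hence is convex, and
it meets `D` in `-Q ∩ D`. A positive `u` with `A u < 0` puts a point of `-Z` into `C`, which forces
faithfulness. The second half of indefiniteness excludes nontrivial nonnegative relations among the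
`α i`, so `Q` is closed. -/

/-- A finite family of walls `x i = 0` of a polyhedral cone, with vectors `α i` along which one
reflects and points `p i` in the relative interiors of the facets, such that the group generated by
the reflections moves the open cone off itself. -/
structure ReflectionChamber (ι V : Type*) [AddCommGroup V] [Module ℝ V] where
  x : ι → Dual ℝ V
  α : ι → V
  p : ι → V
  pairing : ∀ i, x i (α i) = 2
  x_p_self : ∀ i, x i (p i) = 0
  x_p_pos : ∀ i k, k ≠ i → 0 < x k (p i)
  eq_one_of_mem : ∀ w ∈ Subgroup.closure (Set.range fun i => reflection (pairing i)),
    ∀ v, (∀ i, 0 < x i v) → (∀ i, 0 < x i (w v)) → w = 1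

namespace ReflectionChamber

variable {ι V : Type*} [AddCommGroup V] [Module ℝ V] (R : ReflectionChamber ι V)

/-- The reflection at the `i`-th wall. -/
noncomputable def s (i : ι) : V ≃ₗ[ℝ] V := reflection (R.pairing i)

/-- The group generated by the reflections at the walls. -/
def W : Subgroup (V ≃ₗ[ℝ] V) := Subgroup.closure (Set.range R.s)

/-- The open chamber. -/
def C : Set V := {v | ∀ i, 0 < R.x i v}

/-- The closed chamber. -/
def D : Set V := {v | ∀ i, 0 ≤ R.x i v}

/-- Nonnegative combinations of the vectors `α i`. -/
def Q [Fintype ι] : Set V := {v | ∃ a : ι → ℝ, (∀ i, 0 ≤ a i) ∧ v = ∑ i, a i • R.α i}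

variable {R}

theorem s_apply (i : ι) (v : V) : R.s i v = v - R.x i v • R.α i := reflection_apply _ _

theorem s_mem (i : ι) : R.s i ∈ R.W := Subgroup.subset_closure ⟨i, rfl⟩

theorem s_s (i : ι) (v : V) : R.s i (R.s i v) = v := involutive_reflection (R.pairing i) v

theorem s_mul_s (i : ι) : R.s i * R.s i = 1 := LinearEquiv.ext fun v => s_s i v

theorem s_inv (i : ι) : (R.s i)⁻¹ = R.s i := reflection_inv (R.pairing i)

theorem x_s_self (i : ι) (v : V) : R.x i (R.s i v) = -R.x i v := by
  rw [s_apply, map_sub, map_smul, R.pairing, smul_eq_mul]; ring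

theorem s_eq_self {i : ι} {v : V} (h : R.x i v = 0) : R.s i v = v := by
  rw [s_apply, h, zero_smul, sub_zero]

theorem s_ne_one (i : ι) : R.s i ≠ 1 := by
  intro h
  have h1 := x_s_self (R := R) i (R.α i)
  rw [h, LinearEquiv.coe_one, id, R.pairing] at h1
  norm_num at h1

theorem eq_one {w : V ≃ₗ[ℝ] V} (hw : w ∈ R.W) {v : V} (hv : v ∈ R.C) (hwv : w v ∈ R.C) : w = 1 :=
  R.eq_one_of_mem w hw v hv hwv

theorem C_subset_D : R.C ⊆ R.D := fun _ hv i => (hv i).le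

theorem zero_mem_D : (0 : V) ∈ R.D := fun i => by simp

theorem add_mem_D {v w : V} (hv : v ∈ R.D) (hw : w ∈ R.D) : v + w ∈ R.D := fun i => by
  rw [map_add]; exact add_nonneg (hv i) (hw i)

theorem smul_mem_D {v : V} (hv : v ∈ R.D) {r : ℝ} (hr : 0 ≤ r) : r • v ∈ R.D := fun i => by
  rw [map_smul]; exact mul_nonneg hr (hv i)

theorem exists_forall_x_pos [Finite ι] {i : ι} (v : V) : ∃ ε₀ : ℝ, 0 < ε₀ ∧
    ∀ ε, 0 < ε → ε < ε₀ → ∀ k, k ≠ i → 0 < R.x k (R.p i + ε • v) := by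
  have h : ∀ᶠ ε in 𝓝 (0 : ℝ), ∀ k, k ≠ i → 0 < R.x k (R.p i + ε • v) := by
    rw [eventually_all]
    intro k
    by_cases hk : k = i
    · exact Eventually.of_forall fun _ h => absurd hk h
    have hc : Continuous fun ε : ℝ => R.x k (R.p i + ε • v) := by
      simp only [map_add, map_smul, smul_eq_mul]; fun_prop
    have h0 : 0 < R.x k (R.p i + (0 : ℝ) • v) := by simpa using R.x_p_pos i k hk
    filter_upwards [hc.continuousAt.eventually (lt_mem_nhds h0)] with ε hε _ using hε
  obtain ⟨ε₀, h0, hb⟩ := Metric.eventually_nhds_iff.1 h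
  refine ⟨ε₀, h0, fun ε h1 h2 => hb ?_⟩
  rwa [Real.dist_eq, sub_zero, abs_of_pos h1]

theorem exists_mem_C_near [Finite ι] {i : ι} {v : V} (hv : 0 < R.x i v) : ∃ ε₀ : ℝ, 0 < ε₀ ∧
    ∀ ε, 0 < ε → ε < ε₀ → R.p i + ε • v ∈ R.C := by
  obtain ⟨ε₀, h0, h⟩ := R.exists_forall_x_pos (i := i) v
  refine ⟨ε₀, h0, fun ε h1 h2 k => ?_⟩
  by_cases hk : k = i
  · subst hk
    rw [map_add, R.x_p_self, zero_add, map_smul]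
    exact mul_pos h1 hv
  · exact h ε h1 h2 k hk

theorem C_nonempty [Finite ι] : R.C.Nonempty := by
  rcases isEmpty_or_nonempty ι with h | ⟨⟨i⟩⟩
  · exact ⟨0, fun i => isEmptyElim i⟩
  · obtain ⟨ε, h0, h⟩ := exists_mem_C_near (R := R) (i := i) (v := R.α i) (by simp [R.pairing])
    exact ⟨_, h (ε / 2) (by linarith) (by linarith)⟩

/-- If `w v` were on wall `i` with `v ∈ C`, then `w⁻¹ * s i * w` would fix a point of `C` and so be
trivial. Convexity of `C` then excludes mixed signs. -/
theorem pos_or_neg {w : V ≃ₗ[ℝ] V} (hw : w ∈ R.W) (i : ι) :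
    (∀ v ∈ R.C, 0 < R.x i (w v)) ∨ ∀ v ∈ R.C, R.x i (w v) < 0 := by
  have hne : ∀ v ∈ R.C, R.x i (w v) ≠ 0 := by
    intro v hv h0
    have h1 : w⁻¹ * R.s i * w = 1 := by
      refine eq_one (mul_mem (mul_mem (inv_mem hw) (s_mem i)) hw) hv ?_
      have : (w⁻¹ * R.s i * w) v = v := by
        change w⁻¹ (R.s i (w v)) = v
        rw [s_eq_self h0]
        exact w.symm_apply_apply v
      rwa [this]
    exact s_ne_one (R := R) i ((conj_eq_one_iff (a := w⁻¹)).1 (by rwa [inv_inv]))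
  by_contra! h
  obtain ⟨⟨v, hv, hv0⟩, u, hu, hu0⟩ := h
  have hv1 := lt_of_le_of_ne hv0 (hne v hv)
  have hu1 := lt_of_le_of_ne hu0 (hne u hu).symm
  -- The positive combination of `v` and `u` whose image lies on wall `i`.
  refine hne (R.x i (w u) • v + (-R.x i (w v)) • u) (fun k => ?_) ?_
  · rw [map_add, map_smul, map_smul]
    exact add_pos (mul_pos hu1 (hv k)) (mul_pos (by linarith) (hu k))
  · simp only [map_add, map_smul, smul_eq_mul]; ring

theorem nonneg_on_D [Finite ι] {f : Dual ℝ V} (hf : ∀ v ∈ R.C, 0 < f v) {v : V} (hv : v ∈ R.D) :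
    0 ≤ f v := by
  obtain ⟨c, hc⟩ := R.C_nonempty
  refine le_of_forall_pos_le_add fun ε hε => ?_
  have hfc := hf c hc
  have := hf (v + (ε / f c) • c) fun k => by
    rw [map_add, map_smul]
    exact add_pos_of_nonneg_of_pos (hv k) (mul_pos (div_pos hε hfc) (hc k))
  rw [map_add, map_smul, smul_eq_mul, div_mul_cancel₀ _ hfc.ne'] at this
  exact this.le

/-- The form `x i ∘ u` is positive on `C` and negative on `s j C`, so it vanishes on the common
facet. The facet spans the hyperplane `x j = 0`, hence the form is a multiple of `x j` and both
sides reflect in the same hyperplane. They agree because their quotient keeps a point of `C` near `p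
j` in `C`. -/
theorem s_mul_eq_mul_s [Finite ι] {u : V ≃ₗ[ℝ] V} (hu : u ∈ R.W) {i j : ι}
    (hpos : ∀ v ∈ R.C, 0 < R.x i (u v)) (hneg : ∀ v ∈ R.C, R.x i (u (R.s j v)) < 0) :
    R.s i * u = u * R.s j := by
  obtain ⟨f, hf⟩ : ∃ f : Dual ℝ V, ∀ v, f v = R.x i (u v) := ⟨R.x i ∘ₗ u.toLinearMap, fun _ => rfl⟩
  have hD : ∀ v ∈ R.D, R.x j v = 0 → f v = 0 := by
    intro v hv h0
    refine le_antisymm ?_ (nonneg_on_D (fun c hc => by rw [hf]; exact hpos c hc) hv)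
    have := nonneg_on_D (f := -(f ∘ₗ (R.s j).toLinearMap))
      (fun c hc => by simpa [hf] using hneg c hc) hv
    simpa [s_eq_self h0] using this
  have hp : R.p j ∈ R.D := fun k => by
    by_cases hk : k = j
    · rw [hk, R.x_p_self]
    · exact (R.x_p_pos j k hk).le
  have hfp : f (R.p j) = 0 := hD _ hp (R.x_p_self j)
  -- Since `p j` is interior to its facet, a small move along any direction of the hyperplane stays
  -- in the facet.
  have hker : ∀ v, R.x j v = 0 → f v = 0 := by
    intro v hv
    obtain ⟨ε, h0, h⟩ := R.exists_forall_x_pos (i := j) v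
    have hj : R.x j (R.p j + (ε / 2) • v) = 0 := by simp [R.x_p_self, hv]
    have h1 := hD (R.p j + (ε / 2) • v) (fun k => by
      by_cases hk : k = j
      · rw [hk, hj]
      · exact (h (ε / 2) (by linarith) (by linarith) k hk).le) hj
    rw [map_add, map_smul, hfp, zero_add, smul_eq_mul] at h1
    exact (mul_eq_zero.1 h1).resolve_left (by positivity)
  have hprop : ∀ v, f v = f (R.α j) / 2 * R.x j v := by
    intro v
    have := hker (v - (R.x j v / 2) • R.α j) (by
      rw [map_sub, map_smul, R.pairing, smul_eq_mul]; ring)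
    rw [map_sub, map_smul, smul_eq_mul] at this
    linarith
  have hc : f (R.α j) ≠ 0 := by
    intro h0
    obtain ⟨c, hc⟩ := R.C_nonempty
    have := hpos c hc
    rw [← hf, hprop, h0] at this
    simp at this
  set g : V ≃ₗ[ℝ] V := u⁻¹ * R.s i * u * R.s j with hg
  have hgW : g ∈ R.W := mul_mem (mul_mem (mul_mem (inv_mem hu) (s_mem i)) hu) (s_mem j)
  have hga : ∀ v, u (g v) = R.s i (u (R.s j v)) := fun v => u.apply_symm_apply _
  have hgp : g (R.p j) = R.p j := by
    apply u.injective
    rw [hga, s_eq_self (R.x_p_self j), s_eq_self (by rw [← hf, hfp])]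
  have hgx : ∀ v, R.x j (g v) = R.x j v := by
    intro v
    have h1 : f (g v) = f v := by
      rw [hf, hga, x_s_self, ← hf, hprop, hprop v, x_s_self]; ring
    rw [hprop, hprop v] at h1
    exact mul_left_cancel₀ (by simpa using hc) h1
  have hα : 0 < R.x j (R.α j) := by simp [R.pairing]
  obtain ⟨ε, h0, h⟩ := exists_mem_C_near hα
  obtain ⟨δ, h0', h'⟩ := exists_mem_C_near (v := g (R.α j)) ((hgx _).symm ▸ hα)
  have hm : 0 < min ε δ := lt_min h0 h0'
  have hg1 : g = 1 := by
    refine eq_one hgW (h (min ε δ / 2) (by linarith) (by linarith [min_le_left ε δ])) ?_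
    rw [map_add, map_smul, hgp]
    exact h' _ (by linarith) (by linarith [min_le_right ε δ])
  have : R.s i * u = u * g * R.s j := by
    rw [hg]
    simp only [mul_assoc, s_mul_s, mul_one, mul_inv_cancel_left]
  rw [this, hg1, mul_one]

/-! ### Exchange condition and fundamental domain -/

/-- `w` is a product of `n` reflections at walls. -/
inductive IsWord (R : ReflectionChamber ι V) : ℕ → (V ≃ₗ[ℝ] V) → Prop
  | one : IsWord R 0 1
  | mul_s {n : ℕ} {w : V ≃ₗ[ℝ] V} (j : ι) : IsWord R n w → IsWord R (n + 1) (w * R.s j)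

theorem IsWord.mem {n : ℕ} {w : V ≃ₗ[ℝ] V} (h : R.IsWord n w) : w ∈ R.W := by
  induction h with
  | one => exact one_mem _
  | mul_s j _ ih => exact mul_mem ih (s_mem j)

theorem exists_isWord {w : V ≃ₗ[ℝ] V} (h : w ∈ R.W) : ∃ n, R.IsWord n w := by
  refine Subgroup.closure_induction_right (p := fun w _ => ∃ n, R.IsWord n w) ⟨0, .one⟩ ?_ ?_ h
  · rintro w - _ ⟨j, rfl⟩ ⟨n, hn⟩
    exact ⟨n + 1, hn.mul_s j⟩
  · rintro w - _ ⟨j, rfl⟩ ⟨n, hn⟩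
    exact ⟨n + 1, by rw [s_inv]; exact hn.mul_s j⟩

/-- Going through the prefixes of the word, the chamber crosses wall `i` at some letter; by
`s_mul_eq_mul_s` left multiplication by `s i` deletes that letter. -/
theorem IsWord.exchange [Finite ι] {n : ℕ} {w : V ≃ₗ[ℝ] V} (h : R.IsWord n w) {i : ι}
    (hneg : ∀ v ∈ R.C, R.x i (w v) < 0) : ∃ m, m + 1 = n ∧ R.IsWord m (R.s i * w) := by
  induction h with
  | one =>
    obtain ⟨c, hc⟩ := R.C_nonempty
    exact absurd (hneg c hc) (hc i).le.not_gt
  | @mul_s n w j hw ih =>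
    rcases pos_or_neg hw.mem i with hp | hn
    · refine ⟨n, rfl, ?_⟩
      rw [← mul_assoc, s_mul_eq_mul_s hw.mem hp hneg, mul_assoc, s_mul_s, mul_one]
      exact hw
    · obtain ⟨m, rfl, hm⟩ := ih hn
      exact ⟨m + 1, rfl, by rw [← mul_assoc]; exact hm.mul_s j⟩

theorem exists_neg [Finite ι] {w : V ≃ₗ[ℝ] V} (hw : w ∈ R.W) (h1 : w ≠ 1) :
    ∃ i, ∀ v ∈ R.C, R.x i (w v) < 0 := by
  by_contra! h
  obtain ⟨c, hc⟩ := R.C_nonempty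
  refine h1 (eq_one hw hc fun i => ?_)
  rcases pos_or_neg hw i with hp | hn
  · exact hp c hc
  · obtain ⟨v, hv, h0⟩ := h i
    exact absurd (hn v hv) h0.not_gt

/-- Induction over the group: a nontrivial element is `s i * w` with `w` shorter and
`w` on the positive side of the `i`-th wall. -/
theorem induction_W [Finite ι] {P : (V ≃ₗ[ℝ] V) → Prop}
    (ih : ∀ w ∈ R.W, (∀ i, (∀ v ∈ R.C, R.x i (w v) < 0) → P (R.s i * w)) → P w)
    {w : V ≃ₗ[ℝ] V} (hw : w ∈ R.W) : P w := by
  obtain ⟨n, hn⟩ := exists_isWord hw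
  induction n generalizing w with
  | zero =>
    refine ih w hw fun i hi => ?_
    obtain ⟨m, hm, -⟩ := hn.exchange hi
    omega
  | succ n IH =>
    refine ih w hw fun i hi => ?_
    obtain ⟨m, hm, hm'⟩ := hn.exchange hi
    obtain rfl : m = n := by omega
    exact IH hm'.mem hm'

theorem x_nonneg_of_pos [Finite ι] {w : V ≃ₗ[ℝ] V} {i : ι} (h : ∀ v ∈ R.C, 0 < R.x i (w v))
    {v : V} (hv : v ∈ R.D) : 0 ≤ R.x i (w v) :=
  nonneg_on_D (f := R.x i ∘ₗ w.toLinearMap) h hv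

theorem x_nonpos_of_neg [Finite ι] {w : V ≃ₗ[ℝ] V} {i : ι} (h : ∀ v ∈ R.C, R.x i (w v) < 0)
    {v : V} (hv : v ∈ R.D) : R.x i (w v) ≤ 0 := by
  simpa using nonneg_on_D (f := -(R.x i ∘ₗ w.toLinearMap)) (fun c hc => by simpa using h c hc) hv

/-- The closed chamber is a fundamental domain. -/
theorem eq_of_mem_D [Finite ι] {w : V ≃ₗ[ℝ] V} (hw : w ∈ R.W) {v : V} (hv : v ∈ R.D)
    (hwv : w v ∈ R.D) : w v = v := by
  refine induction_W (R := R) (P := fun w => w v ∈ R.D → w v = v) ?_ hw hwv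
  intro w hw ih hwv
  by_cases h1 : w = 1
  · rw [h1]; rfl
  obtain ⟨i, hi⟩ := exists_neg hw h1
  -- `x i (w v)` is at most zero by the choice of `i` and at least zero since `w v ∈ D`, so the
  -- shorter element has the same value at `v`.
  have h2 : (R.s i * w) v = w v := s_eq_self (le_antisymm (x_nonpos_of_neg hi hv) (hwv i))
  have := ih i hi
  rw [h2] at this
  exact this hwv

/-! ### The Tits cone and the root cone -/

/-- The Tits cone. -/
def X (R : ReflectionChamber ι V) : Set V := {v | ∃ w ∈ R.W, w v ∈ R.D}

theorem apply_mem_X {w : V ≃ₗ[ℝ] V} (hw : w ∈ R.W) {v : V} (hv : v ∈ R.X) : w v ∈ R.X := by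
  obtain ⟨u, hu, h⟩ := hv
  refine ⟨u * w⁻¹, mul_mem hu (inv_mem hw), ?_⟩
  have : (u * w⁻¹) (w v) = u v := congrArg u (w.symm_apply_apply v)
  rwa [this]

section Fintype

variable [Fintype ι]

theorem zero_mem_Q : (0 : V) ∈ R.Q := ⟨0, fun _ => le_rfl, by simp⟩

theorem add_mem_Q {v w : V} (hv : v ∈ R.Q) (hw : w ∈ R.Q) : v + w ∈ R.Q := by
  obtain ⟨a, ha, rfl⟩ := hv
  obtain ⟨b, hb, rfl⟩ := hw
  exact ⟨a + b, fun i => add_nonneg (ha i) (hb i), by simp [add_smul, Finset.sum_add_distrib]⟩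

theorem smul_mem_Q {v : V} (hv : v ∈ R.Q) {r : ℝ} (hr : 0 ≤ r) : r • v ∈ R.Q := by
  obtain ⟨a, ha, rfl⟩ := hv
  exact ⟨r • a, fun i => mul_nonneg hr (ha i), by simp [Finset.smul_sum, smul_smul]⟩

theorem smul_α_mem_Q (i : ι) {r : ℝ} (hr : 0 ≤ r) : r • R.α i ∈ R.Q := by
  classical
  refine ⟨Pi.single i r, fun j => ?_, ?_⟩
  · by_cases h : j = i
    · subst h; simpa
    · simp [h]
  · rw [Finset.sum_eq_single i] <;> simp +contextual

/-- Each shortening of `w` by a wall `i` changes the difference by `-x i (w v)` times `α i`, a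
nonnegative multiple. -/
theorem sub_apply_mem_Q {w : V ≃ₗ[ℝ] V} (hw : w ∈ R.W) {v : V} (hv : v ∈ R.D) :
    v - w v ∈ R.Q := by
  refine induction_W (R := R) (P := fun w => v - w v ∈ R.Q) ?_ hw
  intro w hw ih
  by_cases h1 : w = 1
  · rw [h1]; simpa using R.zero_mem_Q
  obtain ⟨i, hi⟩ := exists_neg hw h1
  have h2 : v - w v = (v - (R.s i * w) v) + (-R.x i (w v)) • R.α i := by
    change _ = (v - R.s i (w v)) + _
    rw [s_apply, neg_smul]; abel
  rw [h2]
  exact add_mem_Q (ih i hi) (smul_α_mem_Q i (by linarith [x_nonpos_of_neg hi hv]))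

theorem exists_wall_on_ray {v u : V} (hv : v ∈ R.D) (h : v + u ∉ R.D) :
    ∃ t : ℝ, 0 ≤ t ∧ t < 1 ∧ v + t • u ∈ R.D ∧ ∃ i, R.x i (v + t • u) = 0 ∧ R.x i u < 0 := by
  classical
  simp only [D, Set.mem_ofPred_eq, not_forall, not_le] at h
  obtain ⟨j, hj⟩ := h
  rw [map_add] at hj
  -- The wall hit first when leaving `D` along the ray; the ratio is the time of impact.
  obtain ⟨i, hi, hmin⟩ := Finset.exists_min_image (Finset.univ.filter fun i => R.x i u < 0)
    (fun i => R.x i v / (-R.x i u)) ⟨j, by simpa using by linarith [hv j]⟩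
  simp only [Finset.mem_filter, Finset.mem_univ, true_and] at hi hmin
  have hju : R.x j u < 0 := by linarith [hv j]
  refine ⟨_, div_nonneg (hv i) (by linarith), (hmin j hju).trans_lt ?_, fun k => ?_, i, ?_, hi⟩
  · rw [div_lt_one] <;> linarith
  · rw [map_add, map_smul, smul_eq_mul]
    rcases lt_or_ge (R.x k u) 0 with hk | hk
    · have := hmin k hk
      rw [le_div_iff₀ (by linarith)] at this
      linarith
    · exact add_nonneg (hv k) (mul_nonneg (div_nonneg (hv i) (by linarith)) hk)
  · rw [map_add, map_smul, smul_eq_mul]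
    field_simp
    have : R.x i u ≠ 0 := hi.ne
    field_simp
    ring

/-- The segment from `v` to `v + w u` leaves `D` through a wall `i` with `w C` on its far side.
Reflecting there fixes the exit point and replaces the rest of the segment by a multiple of `(s i *
w) u`, with `s i * w` shorter. -/
theorem add_mem_X_of_mem_D {w : V ≃ₗ[ℝ] V} (hw : w ∈ R.W) {v u : V} (hv : v ∈ R.D)
    (hu : u ∈ R.D) : v + w u ∈ R.X := by
  refine induction_W (R := R) (P := fun w => ∀ v ∈ R.D, ∀ u ∈ R.D, v + w u ∈ R.X)
    ?_ hw v hv u hu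
  intro w hw ih v hv u hu
  by_cases h : v + w u ∈ R.D
  · exact ⟨1, one_mem _, h⟩
  obtain ⟨t, h0, h1, hD, i, hi, hneg⟩ := exists_wall_on_ray hv h
  have hi' : ∀ v ∈ R.C, R.x i (w v) < 0 :=
    (pos_or_neg hw i).resolve_left fun hp => (x_nonneg_of_pos hp hu).not_gt hneg
  have h2 := ih i hi' _ hD ((1 - t) • u) (smul_mem_D hu (by linarith))
  have h3 : R.s i (v + t • w u + (R.s i * w) ((1 - t) • u)) = v + w u := by
    have : (R.s i * w) ((1 - t) • u) = R.s i (w ((1 - t) • u)) := rfl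
    rw [map_add, s_eq_self hi, this, s_s, map_smul]
    module
  rw [← h3]
  exact apply_mem_X (s_mem i) h2

theorem add_mem_X {v u : V} (hv : v ∈ R.X) (hu : u ∈ R.X) : v + u ∈ R.X := by
  obtain ⟨w, hw, hwv⟩ := hv
  obtain ⟨w', hw', hwu⟩ := hu
  have := apply_mem_X (inv_mem hw) (add_mem_X_of_mem_D (mul_mem hw (inv_mem hw')) hwv hwu)
  have h2 : w⁻¹ (w v + (w * w'⁻¹) (w' u)) = v + u := by
    have : (w * w'⁻¹) (w' u) = w u := congrArg w (w'.symm_apply_apply u)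
    rw [this, ← map_add]
    exact w.symm_apply_apply _
  rwa [h2] at this

/-- The translates of the antidominant part of the root cone. -/
theorem exists_apply_mem_iff {v : V} : (∃ w ∈ R.W, w v ∈ R.D ∧ -w v ∈ R.Q) ↔
    v ∈ R.X ∧ ∀ w ∈ R.W, -w v ∈ R.Q := by
  constructor
  · rintro ⟨u, hu, hD, hQ⟩
    refine ⟨⟨u, hu, hD⟩, fun w hw => ?_⟩
    have h := add_mem_Q hQ (sub_apply_mem_Q (mul_mem hw (inv_mem hu)) hD)
    have h2 : (w * u⁻¹) (u v) = w v := congrArg w (u.symm_apply_apply v)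
    rw [h2] at h
    convert h using 1
    abel
  · rintro ⟨⟨u, hu, hD⟩, h⟩
    exact ⟨u, hu, hD, h u hu⟩

end Fintype

/-- Were the entry positive, a suitable combination of `p i` and `p j` would lie in `C` while its
image under `s j` lies on wall `i`, against `pos_or_neg`. -/
theorem x_α_nonpos {i j : ι} (hij : i ≠ j) : R.x i (R.α j) ≤ 0 := by
  by_contra! ha
  have hi := R.x_p_pos i j hij.symm
  have hj := R.x_p_pos j i hij
  set v := (R.x i (R.α j) * R.x j (R.p i)) • R.p j + R.x i (R.p j) • R.p i with hv
  have hC : v ∈ R.C := by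
    intro k
    rw [hv, map_add, map_smul, map_smul, smul_eq_mul, smul_eq_mul]
    by_cases hk : k = i
    · subst hk
      rw [R.x_p_self, mul_zero, add_zero]; positivity
    · have h1 := R.x_p_pos i k hk
      have h2 : 0 ≤ R.x k (R.p j) := by
        by_cases hk' : k = j
        · rw [hk', R.x_p_self]
        · exact (R.x_p_pos j k hk').le
      positivity
  have h0 : R.x i (R.s j v) = 0 := by
    rw [s_apply, hv]
    simp only [map_add, map_sub, map_smul, smul_eq_mul, R.x_p_self]
    ring
  rcases pos_or_neg (R := R) (s_mem j) i with h | h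
  · exact (h v hC).ne' h0
  · exact (h v hC).ne h0

end ReflectionChamber

end

/-! ### Points of an invariant subcone -/

section

open Module Filter Topology

namespace ReflectionChamber

variable {ι V : Type*} [AddCommGroup V] [Module ℝ V] {R : ReflectionChamber ι V}

/-- Let `J` be the set of walls that some point of `Y ∩ D` avoids. The common zero space of the `x
j`, `j ∉ J`, is invariant and contains `Y`, so `hfaith` makes `J` everything; a sum of such points
then avoids all walls. -/
theorem exists_mem_C_of_faithful [Fintype ι] {Y : Set V} (h0 : (0 : V) ∈ Y)
    (hadd : ∀ u ∈ Y, ∀ v ∈ Y, u + v ∈ Y) (hinv : ∀ w ∈ R.W, ∀ y ∈ Y, w y ∈ Y) (hX : Y ⊆ R.X)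
    (hfaith : ∀ i, ∃ y ∈ Y, R.x i y ≠ 0) : ∃ y ∈ Y, y ∈ R.C := by
  classical
  obtain ⟨J, hJ⟩ : ∃ J : Set ι, ∀ i, i ∈ J ↔ ∃ y ∈ Y, y ∈ R.D ∧ 0 < R.x i y := ⟨_, fun _ => Iff.rfl⟩
  have hclosed : ∀ i ∈ J, ∀ j ∉ J, R.x j (R.α i) = 0 := by
    intro i hi j hj
    have hij : j ≠ i := fun h => hj (h ▸ hi)
    by_contra hne
    have hlt := lt_of_le_of_ne (x_α_nonpos hij) hne
    obtain ⟨y, hy, hyD, hyi⟩ := (hJ i).1 hi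
    have hx : ∀ k, R.x k (y + R.s i y) = 2 * R.x k y - R.x i y * R.x k (R.α i) := by
      intro k
      rw [map_add, s_apply, map_sub, map_smul, smul_eq_mul]; ring
    -- Adding the reflected point cancels the `-2` on coordinate `i` and adds a positive amount to
    -- coordinate `j`, so `j` would be in `J`.
    refine hj ((hJ j).2 ⟨y + R.s i y, hadd _ hy _ (hinv _ (s_mem i) _ hy), fun k => ?_, ?_⟩)
    · rw [hx]
      by_cases hk : k = i
      · subst hk; rw [R.pairing]; linarith
      · nlinarith [x_α_nonpos (R := R) hk, hyD k]
    · rw [hx]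
      nlinarith [hyD j]
  have hvanish : ∀ w ∈ R.W, ∀ v : V, (∀ j ∉ J, R.x j v = 0) → ∀ j ∉ J, R.x j (w v) = 0 := by
    intro w hw
    refine Subgroup.closure_induction_left
      (p := fun w _ => ∀ v : V, (∀ j ∉ J, R.x j v = 0) → ∀ j ∉ J, R.x j (w v) = 0)
      (fun v hv => hv) ?_ ?_ hw
    all_goals
      rintro _ ⟨i, rfl⟩ w - ih v hv j hj
      try rw [s_inv]
      change R.x j (R.s i (w v)) = 0
      by_cases hi : i ∈ J
      · rw [s_apply, map_sub, map_smul, hclosed i hi j hj, ih v hv j hj, smul_zero, sub_zero]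
      · rw [s_eq_self (ih v hv i hi), ih v hv j hj]
  have huniv : ∀ j, j ∈ J := by
    intro j
    by_contra hj
    obtain ⟨y, hy, hne⟩ := hfaith j
    obtain ⟨w, hw, hwy⟩ := hX hy
    have h1 := hvanish w⁻¹ (inv_mem hw) (w y) (fun k hk => by
      by_contra hne
      exact hk ((hJ k).2 ⟨_, hinv w hw y hy, hwy, lt_of_le_of_ne (hwy k) (Ne.symm hne)⟩)) j hj
    have h2 : w⁻¹ (w y) = y := w.symm_apply_apply y
    rw [h2] at h1
    exact hne h1
  choose y hyY hyD hy using fun i => (hJ i).1 (huniv i)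
  refine ⟨∑ i, y i, Finset.sum_induction _ (· ∈ Y) (fun u v hu hv => hadd u hu v hv) h0
    fun i _ => hyY i, fun k => ?_⟩
  rw [map_sum]
  exact Finset.sum_pos' (fun i _ => hyD i k) ⟨k, Finset.mem_univ k, hy k⟩

/-- The roots are subtracted one at a time. As off-diagonal entries are nonpositive, earlier
subtractions do not lower coordinate `j`, so `z - a j • α j` stays strictly between `z` and `s j z`
when `a j > 0`. -/
theorem sub_sum_mem [Fintype ι] {Y : Set V}
    (hadd : ∀ u ∈ Y, ∀ v ∈ Y, u + v ∈ Y) (hinv : ∀ w ∈ R.W, ∀ y ∈ Y, w y ∈ Y)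
    (hsmul : ∀ r : ℝ, 0 < r → ∀ y ∈ Y, r • y ∈ Y) {y : V} (hy : y ∈ Y) {a : ι → ℝ}
    (ha : ∀ i, 0 ≤ a i) (hle : ∀ i, a i < R.x i y) : y - ∑ i, a i • R.α i ∈ Y := by
  classical
  suffices ∀ t : Finset ι, y - ∑ i ∈ t, a i • R.α i ∈ Y from this _
  intro t
  induction t using Finset.induction_on with
  | empty => simpa
  | insert j t hj ih =>
    rw [Finset.sum_insert hj]
    set z := y - ∑ i ∈ t, a i • R.α i with hz
    have hzj : a j < R.x j z := by
      rw [hz, map_sub, map_sum]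
      have : ∑ i ∈ t, R.x j (a i • R.α i) ≤ 0 := Finset.sum_nonpos fun i hi => by
        rw [map_smul]
        exact mul_nonpos_of_nonneg_of_nonpos (ha i) (x_α_nonpos fun h => hj (h ▸ hi))
      linarith [hle j]
    have heq : y - (a j • R.α j + ∑ i ∈ t, a i • R.α i) = z - a j • R.α j := by rw [hz]; abel
    rw [heq]
    rcases (ha j).eq_or_lt with h | h
    · rwa [← h, zero_smul, sub_zero]
    have hpos : 0 < R.x j z := h.trans hzj
    have h2 : z - a j • R.α j = (1 - a j / R.x j z) • z + (a j / R.x j z) • R.s j z := by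
      rw [s_apply, smul_sub _ z, smul_smul, div_mul_cancel₀ _ hpos.ne']
      module
    rw [h2]
    refine hadd _ (hsmul _ ?_ _ ih) _ (hsmul _ (div_pos h hpos) _ (hinv _ (s_mem j) _ ih))
    rw [sub_pos, div_lt_one hpos]
    exact hzj

theorem exists_forall_smul_sub_mem [Fintype ι] {Y : Set V} (h0 : (0 : V) ∈ Y)
    (hadd : ∀ u ∈ Y, ∀ v ∈ Y, u + v ∈ Y) (hinv : ∀ w ∈ R.W, ∀ y ∈ Y, w y ∈ Y) (hX : Y ⊆ R.X)
    (hsmul : ∀ r : ℝ, 0 < r → ∀ y ∈ Y, r • y ∈ Y)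
    (hfaith : ∀ i, ∃ y ∈ Y, R.x i y ≠ 0) {v : V} (hv : v ∈ R.Q) (hD : -v ∈ R.D) :
    ∃ y : V, ∀ n : ℕ, (1 / ((n : ℝ) + 1)) • y - v ∈ Y ∩ R.D := by
  obtain ⟨y, hyY, hyC⟩ := exists_mem_C_of_faithful h0 hadd hinv hX hfaith
  obtain ⟨a, ha, rfl⟩ := hv
  obtain ⟨δ, hδ, hδa⟩ : ∃ δ : ℝ, 0 < δ ∧ ∀ i, δ * a i < R.x i y := by
    have h : ∀ᶠ δ in 𝓝[>] (0 : ℝ), ∀ i, δ * a i < R.x i y := by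
      rw [eventually_all]
      intro i
      have hc : Continuous fun δ : ℝ => δ * a i := by fun_prop
      exact (hc.continuousAt.eventually (gt_mem_nhds (by simpa using hyC i))).filter_mono
        nhdsWithin_le_nhds
    obtain ⟨δ, h1, h2⟩ := (h.and self_mem_nhdsWithin).exists
    exact ⟨δ, h2, h1⟩
  set v := ∑ i, a i • R.α i with hv
  -- One `δ` serves for every step, because `-v ∈ D` means that subtracting `v` never decreases a
  -- coordinate.
  have hstep : ∀ n : ℕ, y - (n * δ) • v ∈ Y := by
    intro n
    induction n with
    | zero => simpa
    | succ n ih =>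
      have := sub_sum_mem hadd hinv hsmul ih (a := fun i => δ * a i)
        (fun i => mul_nonneg hδ.le (ha i)) fun i => by
          have h1 := hD i
          rw [map_neg] at h1
          rw [map_sub, map_smul, smul_eq_mul]
          have : 0 ≤ (n * δ) * -R.x i v := by positivity
          linarith [hδa i]
      convert this using 1
      simp only [← smul_smul, ← Finset.smul_sum]
      rw [← hv]
      push_cast
      module
  refine ⟨δ⁻¹ • y, fun n => ?_⟩
  have heq : (1 / ((n : ℝ) + 1)) • δ⁻¹ • y - v =
      (1 / (((n : ℝ) + 1) * δ)) • (y - ((n + 1 : ℕ) * δ) • v) := by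
    have : (n : ℝ) + 1 ≠ 0 := by positivity
    rw [smul_sub, smul_smul, smul_smul]
    congr 2
    · field_simp
    · push_cast
      field_simp
      rw [one_smul]
  constructor
  · rw [heq]
    exact hsmul _ (by positivity) _ (hstep _)
  · rw [sub_eq_add_neg, smul_smul]
    exact add_mem_D (smul_mem_D (C_subset_D hyC) (by positivity)) hD

end ReflectionChamber

/-! ### Closedness of finitely generated cones -/

theorem isClosed_image_nonneg {ι E : Type*} [Fintype ι] [NormedAddCommGroup E] [NormedSpace ℝ E]
    (f : (ι → ℝ) →L[ℝ] E) (hf : ∀ a, 0 ≤ a → f a = 0 → a = 0) :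
    IsClosed (f '' Set.Ici 0) := by
  -- Compactness of the nonnegative part of the unit sphere bounds `f` below. Near any point the
  -- image is therefore that of a compact set.
  obtain ⟨m, hm, hfm⟩ : ∃ m : ℝ, 0 < m ∧ ∀ a, 0 ≤ a → m * ‖a‖ ≤ ‖f a‖ := by
    have hK : IsCompact (Metric.sphere (0 : ι → ℝ) 1 ∩ Set.Ici 0) :=
      (isCompact_sphere _ _).inter_right isClosed_Ici
    obtain ⟨m, hm, h⟩ : ∃ m : ℝ, 0 < m ∧ ∀ a ∈ Metric.sphere (0 : ι → ℝ) 1 ∩ Set.Ici 0,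
        m ≤ ‖f a‖ := by
      rcases (Metric.sphere (0 : ι → ℝ) 1 ∩ Set.Ici 0).eq_empty_or_nonempty with he | hne
      · exact ⟨1, one_pos, by simp [he]⟩
      · obtain ⟨b, ⟨hb1, hb0⟩, hb⟩ := hK.exists_isMinOn hne (f := fun a => ‖f a‖) (by fun_prop)
        refine ⟨‖f b‖, norm_pos_iff.2 fun h => ?_, fun a ha => hb ha⟩
        rw [hf b hb0 h] at hb1
        simp at hb1
    refine ⟨m, hm, fun a ha => ?_⟩
    rcases eq_or_ne a 0 with rfl | hne
    · simp
    have hpos := norm_pos_iff.2 hne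
    have := h (‖a‖⁻¹ • a) ⟨by simp [norm_smul, hpos.ne'], smul_nonneg (by positivity) ha⟩
    rw [map_smul, norm_smul, norm_inv, norm_norm, inv_mul_eq_div, le_div_iff₀ hpos] at this
    exact this
  refine isClosed_of_closure_subset fun y hy => ?_
  have hcpt : IsCompact (f '' (Metric.closedBall 0 ((‖y‖ + 1) / m) ∩ Set.Ici 0)) :=
    ((isCompact_closedBall _ _).inter_right isClosed_Ici).image f.continuous
  have hmem : y ∈ closure (f '' Set.Ici 0 ∩ Metric.ball 0 (‖y‖ + 1)) :=
    Metric.isOpen_ball.closure_inter ⟨hy, by simp⟩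
  refine (Set.image_mono Set.inter_subset_right)
    (hcpt.isClosed.closure_subset_iff.2 ?_ hmem)
  rintro _ ⟨⟨a, ha, rfl⟩, hb⟩
  refine ⟨a, ⟨?_, ha⟩, rfl⟩
  rw [mem_closedBall_zero_iff, le_div_iff₀ hm, mul_comm]
  exact (hfm a ha).trans (mem_ball_zero_iff.1 hb).le

theorem isClosed_moduleTopology_image_nonneg {ι V : Type*} [Fintype ι] [AddCommGroup V]
    [Module ℝ V] [FiniteDimensional ℝ V] (f : (ι → ℝ) →ₗ[ℝ] V)
    (hf : ∀ a, 0 ≤ a → f a = 0 → a = 0) :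
    IsClosed[moduleTopology ℝ V] (f '' Set.Ici 0) := by
  let _ : TopologicalSpace V := moduleTopology ℝ V
  have _ : IsModuleTopology ℝ V := ⟨rfl⟩
  let e : V ≃ₗ[ℝ] (Fin (finrank ℝ V) → ℝ) := (finBasis ℝ V).equivFun
  have he : Continuous e := IsModuleTopology.continuous_of_linearMap e.toLinearMap
  have h := (isClosed_image_nonneg (e.toLinearMap ∘ₗ f).toContinuousLinearMap
    fun a ha h => hf a ha (e.map_eq_zero_iff.1 h)).preimage he
  convert h using 1
  ext v
  simp

end

/-! ### From a linear Coxeter system to a reflection chamber -/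

section

open Module Filter Topology

namespace LinearCoxeterSystem

open LinearCoxeter

variable {ι 𝔥 : Type*} [AddCommGroup 𝔥] [Module ℝ 𝔥] {S : LinearCoxeterSystem ι 𝔥}

theorem exists_isRootBase (S : LinearCoxeterSystem ι 𝔥) : ∃ h α, S.IsRootBase h α := by
  have key : ∀ i, ∃ (h : 𝔥) (α : Dual ℝ 𝔥), h ∈ S.H i ∧ α ∈ S.L i ∧ α h = 2 := by
    intro i
    obtain ⟨h, h0, hH⟩ := S.isRay_H i
    obtain ⟨α, α0, hL⟩ := S.isRay_L i
    have hh : h ∈ S.H i := by rw [hH]; exact ⟨1, zero_le_one, (one_smul _ _).symm⟩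
    have hα : α ∈ S.L i := by rw [hL]; exact ⟨1, zero_le_one, (one_smul _ _).symm⟩
    have hpos : 0 < α h := S.L_subset i ⟨hα, α0⟩ h ⟨hh, h0⟩
    refine ⟨h, (2 / α h) • α, hh, ?_, ?_⟩
    · rw [hL]; exact ⟨_, by positivity, rfl⟩
    · rw [LinearMap.smul_apply, smul_eq_mul, div_mul_cancel₀ _ hpos.ne']
  choose h α hh hα hp using key
  exact ⟨h, α, hh, hα, hp⟩

theorem _root_.LinearCoxeter.IsRay.eq_of_mem {E : Type*} [AddCommGroup E] [Module ℝ E] {T : Set E}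
    (hT : IsRay T) {v : E} (hv : v ∈ T) (h0 : v ≠ 0) : T = {x | ∃ r : ℝ, 0 ≤ r ∧ x = r • v} := by
  obtain ⟨u, hu, rfl⟩ := hT
  obtain ⟨c, hc, rfl⟩ := hv
  have hc0 : c ≠ 0 := fun h => h0 (by rw [h, zero_smul])
  ext x
  constructor
  · rintro ⟨r, hr, rfl⟩
    exact ⟨r / c, by positivity, by rw [smul_smul, div_mul_cancel₀ _ hc0]⟩
  · rintro ⟨r, hr, rfl⟩
    exact ⟨r * c, by positivity, by rw [smul_smul]⟩

namespace IsRootBase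

variable {h : ι → 𝔥} {α : ι → Dual ℝ 𝔥} (hb : S.IsRootBase h α)

include hb

theorem h_ne_zero (i : ι) : h i ≠ 0 := fun h0 => by
  have := hb.pairing i
  rw [h0, map_zero] at this
  norm_num at this

theorem α_ne_zero (i : ι) : α i ≠ 0 := fun h0 => by
  have := hb.pairing i
  rw [h0, LinearMap.zero_apply] at this
  norm_num at this

theorem H_eq (i : ι) : S.H i = {x | ∃ r : ℝ, 0 ≤ r ∧ x = r • h i} :=
  (S.isRay_H i).eq_of_mem (hb.h_mem i) (hb.h_ne_zero i)

theorem L_eq (i : ι) : S.L i = {x | ∃ r : ℝ, 0 ≤ r ∧ x = r • α i} :=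
  (S.isRay_L i).eq_of_mem (hb.α_mem i) (hb.α_ne_zero i)

theorem mem_closedC {φ : Dual ℝ 𝔥} : φ ∈ S.closedC ↔ ∀ i, 0 ≤ φ (h i) := by
  simp only [closedC, closedChamber, nonnegHalfSpace, Set.mem_iInter, Set.mem_ofPred_eq]
  refine forall_congr' fun i => ⟨fun H => H _ (hb.h_mem i), fun H x hx => ?_⟩
  rw [hb.H_eq] at hx
  obtain ⟨r, hr, rfl⟩ := hx
  rw [map_smul]
  exact mul_nonneg hr H

theorem mem_openChamber {φ : Dual ℝ 𝔥} : φ ∈ openChamber S.H ↔ ∀ i, 0 < φ (h i) := by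
  simp only [openChamber, posHalfSpace, Set.mem_iInter, Set.mem_ofPred_eq]
  refine forall_congr' fun i => ⟨fun H => H _ ⟨hb.h_mem i, hb.h_ne_zero i⟩, ?_⟩
  rintro H x ⟨hx, hx0⟩
  rw [hb.H_eq] at hx
  obtain ⟨r, hr, rfl⟩ := hx
  rw [map_smul]
  exact mul_pos (lt_of_le_of_ne hr fun h0 => hx0 (by simp [← h0])) H

theorem mem_zeroHyperplane {φ : Dual ℝ 𝔥} {i : ι} :
    φ ∈ zeroHyperplane (S.H i) ↔ φ (h i) = 0 := by
  refine ⟨fun H => H _ (hb.h_mem i), fun H x hx => ?_⟩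
  rw [hb.H_eq] at hx
  obtain ⟨r, hr, rfl⟩ := hx
  rw [map_smul, H, smul_zero]

theorem eval_pairing (i : ι) : Dual.eval ℝ 𝔥 (h i) (α i) = 2 := hb.pairing i

theorem isReflection_iff {i : ι} {σ : Dual ℝ 𝔥 ≃ₗ[ℝ] Dual ℝ 𝔥} :
    IsReflection (S.H i) (S.L i) σ ↔ reflection (hb.eval_pairing i) = σ := by
  constructor
  · rintro ⟨h1, h2⟩
    ext1 φ
    have hα := h2 (α i) (Or.inl (hb.α_mem i))
    have hφ := h1 (φ - (φ (h i) / 2) • α i) (hb.mem_zeroHyperplane.2 (by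
      rw [LinearMap.sub_apply, LinearMap.smul_apply, hb.pairing, smul_eq_mul]; ring))
    rw [map_sub, map_smul, hα, sub_eq_iff_eq_add] at hφ
    rw [reflection_apply, hφ, Dual.eval_apply]
    module
  · rintro rfl
    refine ⟨fun φ hφ => ?_, ?_⟩
    · rw [reflection_apply, Dual.eval_apply, hb.mem_zeroHyperplane.1 hφ, zero_smul, sub_zero]
    · have key : ∀ φ ∈ S.L i, reflection (hb.eval_pairing i) φ = -φ := by
        intro φ hφ
        rw [hb.L_eq] at hφ
        obtain ⟨r, -, rfl⟩ := hφ
        rw [map_smul, reflection_apply_self, smul_neg]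
      rintro φ (hφ | hφ)
      · exact key φ hφ
      · have := key _ hφ
        rwa [map_neg, neg_inj] at this

theorem W_eq :
    S.W = Subgroup.closure (Set.range fun i => reflection (hb.eval_pairing i)) := by
  rw [W, reflectionGroup]
  congr 1
  ext σ
  exact exists_congr fun i => hb.isReflection_iff

theorem finrank_ker_eval_add_one [FiniteDimensional ℝ 𝔥] (i : ι) :
    finrank ℝ (LinearMap.ker (Dual.eval ℝ 𝔥 (h i))) + 1 = finrank ℝ (Dual ℝ 𝔥) := by
  have h2 := (Dual.eval ℝ 𝔥 (h i)).finrank_range_add_finrank_ker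
  rw [LinearMap.range_eq_top.2 (LinearMap.surjective fun h0 => ?_), finrank_top, finrank_self,
    add_comm] at h2
  · exact h2
  have := hb.eval_pairing i
  rw [h0, LinearMap.zero_apply] at this
  norm_num at this

/-- The span lies in the hyperplane and has the same dimension, by the codimension-one condition on
facets. -/
theorem span_facet_eq [FiniteDimensional ℝ 𝔥] (i : ι) :
    Submodule.span ℝ (closedChamber S.H ∩ zeroHyperplane (S.H i)) =
      LinearMap.ker (Dual.eval ℝ 𝔥 (h i)) := by
  have hf : IsFacet (closedChamber S.H) (closedChamber S.H ∩ zeroHyperplane (S.H i)) := by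
    have := Set.mem_range_self (f := fun i => closedChamber S.H ∩ zeroHyperplane (S.H i)) i
    rwa [S.range_facet] at this
  have hle : Submodule.span ℝ (closedChamber S.H ∩ zeroHyperplane (S.H i)) ≤
      LinearMap.ker (Dual.eval ℝ 𝔥 (h i)) :=
    Submodule.span_le.2 fun φ hφ => hb.mem_zeroHyperplane.1 hφ.2
  refine Submodule.eq_of_le_of_finrank_le hle ?_
  have h1 := hf.2
  have h2 := hb.finrank_ker_eval_add_one i
  omega

/-- If `h k` vanished on the whole facet `i`, the two hyperplanes would coincide and so would the
facets. Summing one witness for each `k` gives a point avoiding all other walls. -/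
theorem exists_mem_facet [FiniteDimensional ℝ 𝔥] [Fintype ι] (i : ι) :
    ∃ φ : Dual ℝ 𝔥, φ (h i) = 0 ∧ ∀ k, k ≠ i → 0 < φ (h k) := by
  classical
  have key : ∀ k, ∃ φ : Dual ℝ 𝔥, φ (h i) = 0 ∧ φ ∈ S.closedC ∧ (k ≠ i → 0 < φ (h k)) := by
    intro k
    by_cases hk : k = i
    · exact ⟨0, rfl, hb.mem_closedC.2 fun _ => le_rfl, fun h => absurd hk h⟩
    by_contra! hcon
    refine hk (S.facet_injective ?_)
    have hle : LinearMap.ker (Dual.eval ℝ 𝔥 (h i)) ≤ LinearMap.ker (Dual.eval ℝ 𝔥 (h k)) := by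
      rw [← hb.span_facet_eq i]
      refine Submodule.span_le.2 fun φ hφ => ?_
      have := (hcon φ (hb.mem_zeroHyperplane.1 hφ.2) hφ.1).2
      exact le_antisymm this (hb.mem_closedC.1 hφ.1 k)
    have heq := Submodule.eq_of_le_of_finrank_le hle (by
      have h1 := hb.finrank_ker_eval_add_one i
      have h2 := hb.finrank_ker_eval_add_one k
      omega)
    change closedChamber S.H ∩ _ = closedChamber S.H ∩ _
    ext φ
    refine and_congr_right fun _ => ?_
    rw [hb.mem_zeroHyperplane, hb.mem_zeroHyperplane]
    exact (SetLike.ext_iff.1 heq φ).symm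
  choose φ h0 hD hpos using key
  refine ⟨∑ k, φ k, ?_, fun k hk => ?_⟩
  · rw [LinearMap.sum_apply]
    exact Finset.sum_eq_zero fun k _ => h0 k
  · rw [LinearMap.sum_apply]
    exact Finset.sum_pos' (fun j _ => hb.mem_closedC.1 (hD j) k) ⟨k, Finset.mem_univ k, hpos k hk⟩

end IsRootBase

/-- The reflection chamber in the dual space that belongs to a root base. -/
noncomputable def IsRootBase.chamber [FiniteDimensional ℝ 𝔥] [Fintype ι] {h : ι → 𝔥}
    {α : ι → Dual ℝ 𝔥} (hb : S.IsRootBase h α) : ReflectionChamber ι (Dual ℝ 𝔥) where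
  x i := Dual.eval ℝ 𝔥 (h i)
  α := α
  p i := (hb.exists_mem_facet i).choose
  pairing := hb.eval_pairing
  x_p_self i := (hb.exists_mem_facet i).choose_spec.1
  x_p_pos i := (hb.exists_mem_facet i).choose_spec.2
  eq_one_of_mem w hw v hv hwv := by
    by_contra h1
    rw [← hb.W_eq] at hw
    have := S.disjoint_openChamber w hw h1
    exact (Set.ext_iff.1 this (w v)).1
      ⟨⟨v, hb.mem_openChamber.2 hv, rfl⟩, hb.mem_openChamber.2 hwv⟩

/-! ### The dual imaginary cone -/

namespace IsRootBase

variable [FiniteDimensional ℝ 𝔥] [Fintype ι] {h : ι → 𝔥} {α : ι → Dual ℝ 𝔥}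
  (hb : S.IsRootBase h α)

include hb

theorem chamber_W : hb.chamber.W = S.W := hb.W_eq.symm

theorem chamber_D : hb.chamber.D = S.closedC := Set.ext fun _ => hb.mem_closedC.symm

theorem chamber_Q : hb.chamber.Q = S.rootCone := by
  ext β
  constructor
  · rintro ⟨a, ha, rfl⟩
    exact ⟨fun i => a i • α i, fun i => by rw [hb.L_eq]; exact ⟨a i, ha i, rfl⟩, rfl⟩
  · rintro ⟨f, hf, rfl⟩
    simp only [hb.L_eq] at hf
    choose a ha h using hf
    exact ⟨a, ha, Finset.sum_congr rfl fun i _ => h i⟩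

theorem chamber_X : hb.chamber.X = S.titsCone := by
  ext v
  simp only [ReflectionChamber.X, titsCone, chamber_W, chamber_D, Set.mem_iUnion,
    Set.mem_ofPred_eq]
  constructor
  · rintro ⟨w, hw, h⟩
    exact ⟨w⁻¹, inv_mem hw, w v, h, w.symm_apply_apply v⟩
  · rintro ⟨w, hw, u, hu, rfl⟩
    refine ⟨w⁻¹, inv_mem hw, ?_⟩
    have : w⁻¹ (w u) = u := w.symm_apply_apply u
    rwa [this]

theorem mem_neg_dualImaginaryCone {v : Dual ℝ 𝔥} : v ∈ -S.dualImaginaryCone ↔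
    ∃ w ∈ hb.chamber.W, w v ∈ hb.chamber.D ∧ -w v ∈ hb.chamber.Q := by
  simp only [chamber_W, chamber_D, chamber_Q, dualImaginaryCone, dualK, Set.mem_neg,
    Set.mem_iUnion]
  constructor
  · rintro ⟨w, hw, u, ⟨hQ, hC⟩, h⟩
    have hu : w⁻¹ v = -u := by
      have : w⁻¹ (w u) = u := w.symm_apply_apply u
      rw [← this, h, map_neg, neg_neg]
    exact ⟨w⁻¹, inv_mem hw, by rw [hu]; exact hC, by rw [hu, neg_neg]; exact hQ⟩
  · rintro ⟨w, hw, hC, hQ⟩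
    refine ⟨w⁻¹, inv_mem hw, -w v, ⟨hQ, by rwa [Set.mem_neg, neg_neg]⟩, ?_⟩
    rw [map_neg]
    exact congrArg _ (w.symm_apply_apply v)

theorem isInvariantSubcone_neg_dualImaginaryCone : S.IsInvariantSubcone (-S.dualImaginaryCone) := by
  have hadd : ∀ u ∈ -S.dualImaginaryCone, ∀ v ∈ -S.dualImaginaryCone,
      u + v ∈ -S.dualImaginaryCone := by
    intro u hu v hv
    -- The reformulation replaces a union of translates by conditions that are each stable under
    -- addition.
    rw [hb.mem_neg_dualImaginaryCone, ReflectionChamber.exists_apply_mem_iff] at hu hv ⊢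
    refine ⟨ReflectionChamber.add_mem_X hu.1 hv.1, fun w hw => ?_⟩
    rw [map_add, neg_add]
    exact ReflectionChamber.add_mem_Q (hu.2 w hw) (hv.2 w hw)
  have hsmul : ∀ r : ℝ, 0 ≤ r → ∀ v ∈ -S.dualImaginaryCone, r • v ∈ -S.dualImaginaryCone := by
    intro r hr v hv
    rw [hb.mem_neg_dualImaginaryCone] at hv ⊢
    obtain ⟨w, hw, hD, hQ⟩ := hv
    refine ⟨w, hw, ?_, ?_⟩
    · rw [map_smul]; exact ReflectionChamber.smul_mem_D hD hr
    · rw [map_smul, ← show r • -w v = -(r • w v) from smul_neg r (w v)]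
      exact ReflectionChamber.smul_mem_Q hQ hr
  refine ⟨?_, ?_, fun r hr => hsmul r hr.le, ?_, ?_⟩
  · rw [hb.mem_neg_dualImaginaryCone]
    exact ⟨1, one_mem _, by simpa using ReflectionChamber.zero_mem_D,
      by simpa using ReflectionChamber.zero_mem_Q⟩
  · intro u hu v hv a b ha hb _
    exact hadd _ (hsmul a ha u hu) _ (hsmul b hb v hv)
  · intro v hv
    rw [hb.mem_neg_dualImaginaryCone] at hv
    obtain ⟨w, hw, hD, -⟩ := hv
    rw [← hb.chamber_X]
    exact ⟨w, hw, hD⟩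
  · intro σ hσ v hv
    rw [hb.mem_neg_dualImaginaryCone] at hv ⊢
    obtain ⟨w, hw, hD, hQ⟩ := hv
    rw [← hb.chamber_W] at hσ
    have : (w * σ⁻¹) (σ v) = w v := congrArg w (σ.symm_apply_apply v)
    exact ⟨w * σ⁻¹, mul_mem hw (inv_mem hσ), by rwa [this], by rwa [this]⟩

theorem neg_dualImaginaryCone_subset {Y : Set (Dual ℝ 𝔥)} (hY : S.IsInvariantSubcone Y)
    (hfaith : S.ActsFaithfullyOn Y) (hclosed : S.HasClosedChamberPart Y) :
    -S.dualImaginaryCone ⊆ Y := by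
  intro v hv
  rw [hb.mem_neg_dualImaginaryCone] at hv
  obtain ⟨w, hw, hD, hQ⟩ := hv
  suffices w v ∈ Y by
    rw [hb.chamber_W] at hw
    have h1 := hY.invariant w⁻¹ (inv_mem hw) _ this
    have h2 : w⁻¹ (w v) = v := w.symm_apply_apply v
    rwa [h2] at h1
  have hadd : ∀ u ∈ Y, ∀ v ∈ Y, u + v ∈ Y := by
    intro u hu v hv
    have := hY.smul_mem 2 two_pos _
      (hY.convex hu hv (by norm_num : (0 : ℝ) ≤ 1 / 2) (by norm_num : (0 : ℝ) ≤ 1 / 2) (by norm_num))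
    convert this using 1
    module
  obtain ⟨y, hy⟩ := ReflectionChamber.exists_forall_smul_sub_mem (R := hb.chamber) hY.zero_mem hadd
    (by rw [hb.chamber_W]; exact hY.invariant) (by rw [hb.chamber_X]; exact hY.subset_titsCone)
    hY.smul_mem (fun i => by
      by_contra! h0
      refine ReflectionChamber.s_ne_one (R := hb.chamber) i (hfaith _ ?_ fun y hy => ?_)
      · rw [← hb.chamber_W]; exact ReflectionChamber.s_mem i
      · exact ReflectionChamber.s_eq_self (h0 y hy)) hQ (by rwa [neg_neg])
  simp only [sub_neg_eq_add, hb.chamber_D] at hy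
  let _ : TopologicalSpace (Dual ℝ 𝔥) := moduleTopology ℝ (Dual ℝ 𝔥)
  have _ : IsModuleTopology ℝ (Dual ℝ 𝔥) := ⟨rfl⟩
  have _ : ContinuousAdd (Dual ℝ 𝔥) := IsModuleTopology.toContinuousAdd ℝ _
  have hlim : Tendsto (fun n : ℕ => (1 / ((n : ℝ) + 1)) • y + w v) atTop
      (𝓝 ((0 : ℝ) • y + w v)) :=
    (tendsto_one_div_add_atTop_nhds_zero_nat.smul_const y).add_const _
  rw [zero_smul, zero_add] at hlim
  exact (IsClosed.mem_of_tendsto hclosed hlim (Eventually.of_forall hy)).1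

theorem neg_dualImaginaryCone_inter_closedC :
    -S.dualImaginaryCone ∩ S.closedC = -S.rootCone ∩ S.closedC := by
  ext v
  refine and_congr_left fun hv => ?_
  rw [hb.mem_neg_dualImaginaryCone, Set.mem_neg, ← hb.chamber_Q]
  rw [← hb.chamber_D] at hv
  constructor
  · rintro ⟨w, hw, hD, hQ⟩
    -- Both `v` and `w v` are in `D`, so they coincide.
    rwa [ReflectionChamber.eq_of_mem_D hw hv hD] at hQ
  · intro hQ
    exact ⟨1, one_mem _, hv, hQ⟩

theorem hasClosedChamberPart_neg_dualImaginaryCone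
    (hA : ∀ a : ι → ℝ, 0 ≤ a → ∑ i, a i • α i = 0 → a = 0) :
    S.HasClosedChamberPart (-S.dualImaginaryCone) := by
  rw [HasClosedChamberPart, hb.neg_dualImaginaryCone_inter_closedC]
  have h1 := isClosed_moduleTopology_image_nonneg (-(Fintype.linearCombination ℝ α))
    fun a ha h => hA a ha (by simpa [Fintype.linearCombination_apply] using h)
  have h2 : (-(Fintype.linearCombination ℝ α)) '' Set.Ici 0 = -S.rootCone := by
    ext v
    rw [Set.mem_neg, ← hb.chamber_Q]
    constructor
    · rintro ⟨a, ha, rfl⟩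
      exact ⟨a, ha, by simp [Fintype.linearCombination_apply, chamber]⟩
    · rintro ⟨a, ha, h⟩
      exact ⟨a, ha, by
        rw [LinearMap.neg_apply, Fintype.linearCombination_apply, neg_eq_iff_eq_neg]; exact h.symm⟩
  rw [h2] at h1
  let _ : TopologicalSpace (Dual ℝ 𝔥) := moduleTopology ℝ (Dual ℝ 𝔥)
  have _ : IsModuleTopology ℝ (Dual ℝ 𝔥) := ⟨rfl⟩
  have h3 : S.closedC = ⋂ i, {φ | 0 ≤ Dual.eval ℝ 𝔥 (h i) φ} := by
    ext φ
    rw [hb.mem_closedC, Set.mem_iInter]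
    rfl
  rw [h3]
  exact h1.inter (isClosed_iInter fun i =>
    isClosed_le continuous_const (IsModuleTopology.continuous_of_linearMap _))

/-- The vector `-∑ j, u j • α j` lies in `C` and in `-Z`; only the identity can fix a point of `C`.
-/
theorem actsFaithfullyOn_neg_dualImaginaryCone {u : ι → ℝ} (hu : ∀ i, 0 ≤ u i)
    (hneg : ∀ i, (∑ j, u j • α j) (h i) < 0) : S.ActsFaithfullyOn (-S.dualImaginaryCone) := by
  intro σ hσ hfix
  have hC : -∑ j, u j • α j ∈ hb.chamber.C := fun i => by
    change 0 < (-∑ j, u j • α j) (h i)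
    rw [LinearMap.neg_apply]
    linarith [hneg i]
  have hmem : -∑ j, u j • α j ∈ -S.dualImaginaryCone :=
    hb.mem_neg_dualImaginaryCone.2 ⟨1, one_mem _, ReflectionChamber.C_subset_D hC, u, hu, by
      simp [chamber]⟩
  refine ReflectionChamber.eq_one (R := hb.chamber) (by rwa [hb.chamber_W]) hC ?_
  rwa [hfix _ hmem]

end IsRootBase

end LinearCoxeterSystem

/-! ### Indefinite type, assembled from components -/

namespace LinearCoxeter

variable {ι : Type*} [Fintype ι] {A : Matrix ι ι ℝ}

/-- Entries linking different components vanish, so the matrix is block diagonal. -/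
theorem mulVec_eq_submatrix_mulVec (c : (matrixGraph A).ConnectedComponent) [Fintype c.supp]
    (v : ι → ℝ) (i : c.supp) : A.mulVec v i =
      (A.submatrix (Subtype.val : c.supp → ι) (Subtype.val : c.supp → ι)).mulVec
        (fun j => v j) i := by
  classical
  simp only [Matrix.mulVec, dotProduct, Matrix.submatrix_apply]
  have h0 : ∀ j, j ∉ c.supp → A i j * v j = 0 := by
    intro j hj
    by_contra hne
    have hA : A i j ≠ 0 := left_ne_zero_of_mul hne
    have hij : (i : ι) ≠ j := fun h => hj (h ▸ i.2)
    have hadj : (matrixGraph A).Adj i j :=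
      (SimpleGraph.fromRel_adj _ _ _).2 ⟨hij, Or.inl hA⟩
    exact hj ((SimpleGraph.ConnectedComponent.mem_supp_congr_adj c hadj).1 i.2)
  rw [← Finset.sum_subset (Finset.subset_univ (Finset.univ.filter (· ∈ c.supp)))
    fun j _ hj => h0 j fun h => hj (by simpa using h)]
  exact Finset.sum_subtype _ (by simp) _

theorem isIndefinite_of_indefinitePart_eq_univ (h : indefinitePart A = Set.univ) :
    IsIndefinite A := by
  classical
  have hmem : ∀ c : (matrixGraph A).ConnectedComponent, IsIndefinite
      (A.submatrix (Subtype.val : c.supp → ι) (Subtype.val : c.supp → ι)) := by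
    refine SimpleGraph.ConnectedComponent.ind fun i => ?_
    have hi : i ∈ indefinitePart A := h ▸ Set.mem_univ i
    simp only [indefinitePart, Set.mem_iUnion, Set.mem_ofPred_eq] at hi
    obtain ⟨c, hc, hic⟩ := hi
    rw [SimpleGraph.ConnectedComponent.mem_supp_iff] at hic
    subst hic
    convert hc
  choose h1 h2 using hmem
  choose u hu hAu using h1
  constructor
  · refine ⟨fun i => u ((matrixGraph A).connectedComponentMk i) ⟨i, rfl⟩, fun i => hu _ _, ?_⟩
    intro i
    have h3 := mulVec_eq_submatrix_mulVec ((matrixGraph A).connectedComponentMk i)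
      (fun i => u ((matrixGraph A).connectedComponentMk i) ⟨i, rfl⟩) ⟨i, rfl⟩
    rw [h3]
    have hcoh : ∀ (c : (matrixGraph A).ConnectedComponent) (j : c.supp),
        u ((matrixGraph A).connectedComponentMk j) ⟨j, rfl⟩ = u c j := by
      rintro c ⟨j, hj⟩
      obtain rfl : (matrixGraph A).connectedComponentMk j = c := hj
      rfl
    simp only [hcoh]
    convert hAu ((matrixGraph A).connectedComponentMk i) ⟨i, rfl⟩
  · intro v hv hAv
    ext i
    refine congrFun (h2 ((matrixGraph A).connectedComponentMk i) (fun j => v j) (fun j => hv j)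
      fun j => ?_) ⟨i, rfl⟩
    have h3 := mulVec_eq_submatrix_mulVec ((matrixGraph A).connectedComponentMk i) v j
    convert hAv j using 1
    rw [h3]

end LinearCoxeter

end

theorem mainTheorem12 {ι 𝔥 : Type*} [Fintype ι] [AddCommGroup 𝔥] [Module ℝ 𝔥]
    [FiniteDimensional ℝ 𝔥] (S : LinearCoxeterSystem ι 𝔥) :
    (∀ Y : Set (Module.Dual ℝ 𝔥), S.IsInvariantSubcone Y → S.ActsFaithfullyOn Y →
      S.HasClosedChamberPart Y → -S.dualImaginaryCone ⊆ Y) ∧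
    (∀ (h : ι → 𝔥) (α : ι → Module.Dual ℝ 𝔥), S.IsRootBase h α →
      LinearCoxeter.indefinitePart (LinearCoxeter.cartanMatrix h α) = Set.univ →
      IsLeast {Y : Set (Module.Dual ℝ 𝔥) | S.IsInvariantSubcone Y ∧ S.ActsFaithfullyOn Y ∧
        S.HasClosedChamberPart Y} (-S.dualImaginaryCone)) := by
  obtain ⟨h₀, α₀, hb₀⟩ := S.exists_isRootBase
  refine ⟨fun Y hY hf hc => hb₀.neg_dualImaginaryCone_subset hY hf hc, fun h α hb hI => ?_⟩
  obtain ⟨⟨u, hu, hAu⟩, hA⟩ := LinearCoxeter.isIndefinite_of_indefinitePart_eq_univ hI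
  have hsum : ∀ (a : ι → ℝ) (i : ι),
      (∑ j, a j • α j) (h i) = (LinearCoxeter.cartanMatrix h α).mulVec a i := by
    intro a i
    simp [Matrix.mulVec, dotProduct, LinearCoxeter.cartanMatrix, mul_comm]
  refine ⟨⟨hb.isInvariantSubcone_neg_dualImaginaryCone,
    hb.actsFaithfullyOn_neg_dualImaginaryCone (fun i => (hu i).le) fun i => ?_,
    hb.hasClosedChamberPart_neg_dualImaginaryCone fun a ha h0 => hA a ha fun i => ?_⟩,
    fun Y hY => hb.neg_dualImaginaryCone_subset hY.1 hY.2.1 hY.2.2⟩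
  · rw [hsum]; exact hAu i
  -- A relation `∑ a j • α j = 0` gives `A a = 0`, so indefiniteness applies to `a`.
  · rw [← hsum, h0, LinearMap.zero_apply]
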